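/- For a graph $G$ and a colouring $c$ of its edges with colours $1,\dots,k$, let $f(G,c)$ be the minimum, over the $k$ colours $i$, of the number of connected components of the subgraph formed by the edges of colour $i$, where isolated vertices are not counted as components. Let $f_k(G)$ be the maximum of $f(G,c)$ over all such colourings $c$, and write $f(n,k)=f_k(K_n)$. Let $k\ge 3$ be a fixed integer and let $p$ be the largest prime power satisfying $p^2+p+1\le k$, where $1=\ell^0$ ($\ell$ prime) is counted as a prime power (so $p=1$ when $3\le k\le 6$). Then, as $n\to\infty$, $$n\left(\frac12-\frac1{2\sqrt k}\right)(1+o_n(1))\ \ge\ f(n,k)\ \ge\ n\left(\frac12-\frac{p+1}{2(p^2+p+1)}\right)(1+o_n(1)).$$ -/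

import Mathlib

open Filter Topology

/-- The number of components of `G`, where isolated vertices do not count as components:
the number of connected components with at least two vertices. -/
noncomputable def numEdgeComponents {V : Type*} (G : SimpleGraph V) : ℕ :=
  {C : G.ConnectedComponent | C.supp.Nontrivial}.ncard

/-- For a `k`-edge coloring `c` of `G`, the number of components of the color class
with the least number of components. -/
noncomputable def minColorComponents {V : Type*} {G : SimpleGraph V} {k : ℕ}
    (c : G.EdgeLabeling (Fin k)) : ℕ :=
  ⨅ i : Fin k, numEdgeComponents (c.labelGraph i)

/-- `f_k(G)`: the maximum of `minColorComponents c` over all `k`-edge colorings `c` of the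
graph `G` (a genuine maximum when the vertex set is finite, see below). -/
noncomputable def maxMinComponents {V : Type*} (G : SimpleGraph V) (k : ℕ) : ℕ :=
  ⨆ c : G.EdgeLabeling (Fin k), minColorComponents c

/-- `f(n, k) = f_k(K_n)`. -/
noncomputable def fComplete (n k : ℕ) : ℕ :=
  maxMinComponents (⊤ : SimpleGraph (Fin n)) k

/-- The supremum in `maxMinComponents` is attained and is an upper bound. -/
theorem isGreatest_maxMinComponents {V : Type*} [Finite V] (G : SimpleGraph V) {k : ℕ}
    (hk : 0 < k) :
    IsGreatest (Set.range fun c : G.EdgeLabeling (Fin k) => minColorComponents c)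
      (maxMinComponents G k) := by
  have : Nonempty (G.EdgeLabeling (Fin k)) := ⟨fun _ => ⟨0, hk⟩⟩
  have : Finite (G.EdgeLabeling (Fin k)) := by
    unfold SimpleGraph.EdgeLabeling; infer_instance
  have hb : BddAbove (Set.range fun c : G.EdgeLabeling (Fin k) => minColorComponents c) :=
    (Set.finite_range _).bddAbove
  exact ⟨Nat.sSup_mem (Set.range_nonempty _) hb, fun _ hx => le_csSup hb hx⟩

/-- Powers `ℓ ^ a` of a prime `ℓ` with `a ≥ 0`. Unlike `IsPrimePow`, this admits `1`. -/
def IsPrimePowerOrOne (q : ℕ) : Prop :=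
  ∃ ℓ a : ℕ, ℓ.Prime ∧ q = ℓ ^ a

/-! Upper bound: for a graph on `n` vertices with `N` nontrivial components, the edge count is
largest, up to `O(n)`, when all but one component are single edges, giving at most `(n - 2N)^2 +
O(n)` ordered adjacent pairs. The `k` colours cover all `n(n-1)` pairs, so `n - 2f` is at least
about `n/√k` (`fComplete_upper`).

Lower bound: split the vertices into blobs indexed by the points of a projective plane of order `p`,
with lines as colours. Each pair of blobs is joined in the colour of a line through both, and inside
each of the `p^2` blobs off a line a near-perfect matching is reserved for its colour. The matching
edges are isolated in that colour (`le_fComplete_of_incidence`). -/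

section Components

/-! ### Edge counts and isolated edges -/

variable {V : Type*}

theorem card_adj_pairs_le [Fintype V] (G : SimpleGraph V) [DecidableRel G.Adj] :
    2 * numEdgeComponents G ≤ Fintype.card V ∧
    (Finset.univ.filter fun x : V × V => G.Adj x.1 x.2).card ≤
      (Fintype.card V - 2 * numEdgeComponents G) ^ 2 + 3 * Fintype.card V := by
  classical
  let s : G.ConnectedComponent → Finset V := fun C =>
    Finset.univ.filter fun v => G.connectedComponentMk v = C
  let N : Finset G.ConnectedComponent := Finset.univ.filter fun C => 2 ≤ (s C).card
  have hN : numEdgeComponents G = N.card := by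
    rw [numEdgeComponents, ← Set.ncard_coe_finset]
    congr 1
    ext C
    have : C.supp = (s C : Set V) := by ext v; simp [s]
    simp [N, this, ← Finset.one_lt_card_iff_nontrivial, Nat.lt_iff_add_one_le]
  have hsum : ∑ C ∈ N, (s C).card ≤ Fintype.card V := by
    calc ∑ C ∈ N, (s C).card ≤ ∑ C, (s C).card :=
          Finset.sum_le_sum_of_subset (Finset.subset_univ _)
      _ = Fintype.card V := by
          rw [← Finset.card_univ, Finset.card_eq_sum_card_fiberwise
            (f := G.connectedComponentMk) (t := Finset.univ) (by simp)]
  have hsplit : ∑ C ∈ N, (s C).card = ∑ C ∈ N, ((s C).card - 2) + 2 * N.card := by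
    rw [mul_comm, ← smul_eq_mul, ← Finset.sum_const, ← Finset.sum_add_distrib]
    refine Finset.sum_congr rfl fun C hC => ?_
    have := (Finset.mem_filter.1 hC).2
    omega
  have hpairs : (Finset.univ.filter fun x : V × V => G.Adj x.1 x.2).card ≤
      ∑ C ∈ N, (s C).card * ((s C).card - 1) := by
    rw [Finset.card_eq_sum_card_fiberwise (f := fun x : V × V => G.connectedComponentMk x.1)
      (t := N)]
    · refine Finset.sum_le_sum fun C _ => ?_
      rw [Nat.mul_sub_one, ← Finset.offDiag_card]
      refine Finset.card_le_card fun x hx => ?_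
      simp only [Finset.mem_filter, Finset.mem_univ, true_and] at hx
      have : G.connectedComponentMk x.2 = G.connectedComponentMk x.1 :=
        SimpleGraph.ConnectedComponent.eq.2 hx.1.symm.reachable
      simp [s, Finset.mem_offDiag, hx.2, this, hx.1.ne]
    · intro x hx
      have hx : G.Adj x.1 x.2 := by simpa using hx
      simp only [N, Finset.coe_filter, Finset.mem_univ, true_and, Set.mem_ofPred_eq]
      exact Finset.one_lt_card.2 ⟨x.1, by simp [s], x.2, by simpa [s] using hx.symm.reachable, hx.ne⟩
  have hsq : ∑ C ∈ N, ((s C).card - 2) ^ 2 ≤ (∑ C ∈ N, ((s C).card - 2)) ^ 2 :=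
    Finset.sum_sq_le_sq_sum_of_nonneg fun _ _ => Nat.zero_le _
  -- With `t = s - 2`, `s(s-1) = t^2 + 3t + 2`; the linear terms give the error `3n`.
  have hterm : ∑ C ∈ N, (s C).card * ((s C).card - 1) =
      ∑ C ∈ N, ((s C).card - 2) ^ 2 + 3 * ∑ C ∈ N, ((s C).card - 2) + 2 * N.card := by
    rw [mul_comm 2, ← smul_eq_mul N.card, ← Finset.sum_const, Finset.mul_sum,
      ← Finset.sum_add_distrib, ← Finset.sum_add_distrib]
    refine Finset.sum_congr rfl fun C hC => ?_
    obtain ⟨t, ht⟩ := Nat.exists_eq_add_of_le (Finset.mem_filter.1 hC).2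
    rw [ht, Nat.add_sub_cancel_left, show 2 + t - 1 = t + 1 by omega]
    ring
  rw [hN]
  refine ⟨by omega, ?_⟩
  have hT : ∑ C ∈ N, ((s C).card - 2) ≤ Fintype.card V - 2 * N.card := by omega
  have := Nat.pow_le_pow_left hT 2
  omega

/-- Each edge `a i`–`b i` is a whole component, since neither end has another neighbour. -/
theorem card_le_numEdgeComponents [Finite V] (G : SimpleGraph V) {ι : Type*} [Fintype ι]
    (a b : ι → V) (hadj : ∀ i, G.Adj (a i) (b i))
    (ha : ∀ i v, G.Adj (a i) v → v = b i) (hb : ∀ i v, G.Adj (b i) v → v = a i)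
    (hinj : ∀ i j, a j = a i ∨ a j = b i → i = j) :
    Fintype.card ι ≤ numEdgeComponents G := by
  have hreach : ∀ i v, G.Reachable (a i) v → v = a i ∨ v = b i := by
    intro i v h
    rw [SimpleGraph.reachable_iff_reflTransGen] at h
    induction h with
    | refl => exact Or.inl rfl
    | tail _ hvw ih =>
      rcases ih with rfl | rfl
      · exact Or.inr (ha i _ hvw)
      · exact Or.inl (hb i _ hvw)
  rw [← Nat.card_eq_fintype_card, ← Set.ncard_univ]
  refine Set.ncard_le_ncard_of_injOn (fun i => G.connectedComponentMk (a i)) ?_ ?_ (Set.toFinite _)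
  · intro i _
    exact ⟨a i, rfl, b i, SimpleGraph.ConnectedComponent.eq.2 (hadj i).symm.reachable, (hadj i).ne⟩
  · intro i _ j _ h
    exact hinj i j (hreach i _ (SimpleGraph.ConnectedComponent.eq.1 h))

end Components

/-! ### Counting bound from above -/

theorem minColorComponents_le {V : Type*} {G : SimpleGraph V} {k : ℕ}
    (c : G.EdgeLabeling (Fin k)) (i : Fin k) :
    minColorComponents c ≤ numEdgeComponents (c.labelGraph i) :=
  ciInf_le (OrderBot.bddBelow _) i

theorem fComplete_upper (n k : ℕ) (hk : 0 < k) :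
    2 * fComplete n k ≤ n ∧
      n * (n - 1) ≤ k * ((n - 2 * fComplete n k) ^ 2 + 3 * n) := by
  classical
  obtain ⟨c, hc : minColorComponents c = fComplete n k⟩ :=
    (isGreatest_maxMinComponents (⊤ : SimpleGraph (Fin n)) hk).1
  have hi : ∀ i, fComplete n k ≤ numEdgeComponents (c.labelGraph i) := fun i =>
    hc ▸ minColorComponents_le c i
  have hcol : ∀ i, (Finset.univ.filter fun x : Fin n × Fin n =>
      (c.labelGraph i).Adj x.1 x.2).card ≤ (n - 2 * fComplete n k) ^ 2 + 3 * n := by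
    intro i
    have h := (card_adj_pairs_le (c.labelGraph i)).2
    rw [Fintype.card_fin] at h
    have := Nat.pow_le_pow_left
      (show n - 2 * numEdgeComponents (c.labelGraph i) ≤ n - 2 * fComplete n k by
        have := hi i; omega) 2
    omega
  constructor
  · have h := (card_adj_pairs_le (c.labelGraph ⟨0, hk⟩)).1
    rw [Fintype.card_fin] at h
    have := hi ⟨0, hk⟩
    omega
  · calc n * (n - 1) = ((Finset.univ : Finset (Fin n)).offDiag).card := by
          rw [Finset.offDiag_card, Finset.card_univ, Fintype.card_fin, Nat.mul_sub_one]
      _ ≤ (Finset.univ.biUnion fun i : Fin k => Finset.univ.filter fun x : Fin n × Fin n =>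
            (c.labelGraph i).Adj x.1 x.2).card := by
          refine Finset.card_le_card fun x hx => ?_
          have hne : x.1 ≠ x.2 := (Finset.mem_offDiag.1 hx).2.2
          simp only [Finset.mem_biUnion, Finset.mem_filter, Finset.mem_univ, true_and]
          exact ⟨c ⟨s(x.1, x.2), hne⟩, (SimpleGraph.EdgeLabeling.labelGraph_adj _ _).2 ⟨hne, rfl⟩⟩
      _ ≤ _ := Finset.card_biUnion_le
      _ ≤ ∑ _i : Fin k, ((n - 2 * fComplete n k) ^ 2 + 3 * n) :=
          Finset.sum_le_sum fun i _ => hcol i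
      _ = _ := by simp

/-! ### Blow-up of an incidence structure -/

/-- Blow-up construction: the vertex `v` of `K_n` lies in the blob `v % q`; a colour `i` is an
isolated matching in the blobs not incident with it. -/
theorem le_fComplete_of_incidence {q k d : ℕ} (n : ℕ) (hq : 0 < q)
    (I : Fin q → Fin k → Prop) (hI : ∀ a b, ∃ i, I a i ∧ I b i)
    (hd : ∀ i, d ≤ Nat.card {b // ¬ I b i}) :
    d * ((n / q - k) / 2) ≤ fComplete n k := by
  classical
  have hk : 0 < k := by
    obtain ⟨i, -⟩ := hI ⟨0, hq⟩ ⟨0, hq⟩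
    exact i.pos
  have : Nonempty (Fin k) := ⟨⟨0, hk⟩⟩
  let blob : Fin n → Fin q := fun v => ⟨v % q, Nat.mod_lt _ hq⟩
  -- Within a blob the indices of matched vertices sum to `n / q - 1 - i`: partners are unique, and
  -- distinct colours reserve disjoint edges.
  let M : Fin k → Fin n → Fin n → Prop := fun i u v =>
    blob u = blob v ∧ ¬ I (blob u) i ∧ (u : ℕ) / q + v / q + i + 1 = n / q
  have hvert : ∀ u v : Fin n, blob u = blob v → (u : ℕ) / q = v / q → u = v := by
    intro u v h h'
    have h : (u : ℕ) % q = v % q := congrArg Fin.val h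
    ext
    rw [← Nat.div_add_mod u q, ← Nat.div_add_mod v q, h, h']
  have hcol : ∀ e : Sym2 (Fin n), ∃ c : Fin k,
      ∀ u v, e = s(u, v) → (M c u v ∨ (I (blob u) c ∧ I (blob v) c)) ∧
        ∀ i, M i u v → c = i := by
    intro e
    induction e with
    | _ x y =>
    have hsymm : ∀ i, M i x y → M i y x := fun i ⟨h1, h2, h3⟩ => ⟨h1.symm, h1 ▸ h2, by omega⟩
    have hsymm' : ∀ i, M i y x → M i x y := fun i ⟨h1, h2, h3⟩ => ⟨h1.symm, h1 ▸ h2, by omega⟩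
    by_cases h : ∃ i, M i x y
    · obtain ⟨i, hi⟩ := h
      have huniq : ∀ j, M j x y → i = j := fun j hj => by
        have := hi.2.2
        have := hj.2.2
        ext
        omega
      refine ⟨i, fun u v huv => ?_⟩
      rcases Sym2.eq_iff.1 huv with ⟨rfl, rfl⟩ | ⟨rfl, rfl⟩
      · exact ⟨Or.inl hi, huniq⟩
      · exact ⟨Or.inl (hsymm i hi), fun j hj => huniq j (hsymm' j hj)⟩
    · obtain ⟨i, hi⟩ := hI (blob x) (blob y)
      refine ⟨i, fun u v huv => ?_⟩
      rcases Sym2.eq_iff.1 huv with ⟨rfl, rfl⟩ | ⟨rfl, rfl⟩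
      · exact ⟨Or.inr hi, fun j hj => (h ⟨j, hj⟩).elim⟩
      · exact ⟨Or.inr hi.symm, fun j hj => (h ⟨j, hsymm' j hj⟩).elim⟩
  choose col hcol using hcol
  let c : (⊤ : SimpleGraph (Fin n)).EdgeLabeling (Fin k) := fun e => col e
  have hadj : ∀ i u v, (c.labelGraph i).Adj u v ↔ u ≠ v ∧ col s(u, v) = i := by
    intro i u v
    rw [SimpleGraph.EdgeLabeling.labelGraph_adj]
    exact ⟨fun ⟨h, h'⟩ => ⟨h, h'⟩, fun ⟨h, h'⟩ => ⟨h, h'⟩⟩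
  refine le_trans ?_ ((isGreatest_maxMinComponents (⊤ : SimpleGraph (Fin n)) hk).2 ⟨c, rfl⟩)
  refine le_ciInf fun i => ?_
  have hlt : ∀ (x : ℕ) (b : Fin q), x < n / q → x * q + b < n := by
    intro x b hx
    have h1 : (x + 1) * q ≤ n / q * q := Nat.mul_le_mul_right q hx
    have h2 := Nat.div_mul_le_self n q
    have := b.2
    rw [add_mul] at h1
    omega
  let vtx : ∀ (x : ℕ) (b : Fin q), x < n / q → Fin n := fun x b hx => ⟨x * q + b, hlt x b hx⟩
  have hblob : ∀ x b hx, blob (vtx x b hx) = b := by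
    intro x b hx
    ext
    simp [blob, vtx, Nat.mod_eq_of_lt b.2]
  have hidx : ∀ x b hx, ((vtx x b hx : Fin n) : ℕ) / q = x := by
    intro x b hx
    have : ((b : ℕ) + x * q) / q = x := by
      rw [Nat.add_mul_div_right _ _ hq, Nat.div_eq_of_lt b.2, zero_add]
    simpa [vtx, add_comm] using this
  have hM : ∀ u v, ¬ I (blob u) i → (c.labelGraph i).Adj u v → M i u v := by
    intro u v hu huv
    obtain ⟨-, rfl⟩ := (hadj i u v).1 huv
    exact (hcol _ u v rfl).1.resolve_right fun h => hu h.1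
  have hx : ∀ x : Fin ((n / q - k) / 2), (x : ℕ) < n / q ∧ n / q - 1 - i - x < n / q := by
    intro x
    have := x.2
    omega
  -- As `i < k`, an index below `(n / q - k) / 2` is strictly less than its partner's, so no edge
  -- degenerates or repeats.
  let a : {b // ¬ I b i} × Fin ((n / q - k) / 2) → Fin n := fun z => vtx z.2 z.1 (hx z.2).1
  let b : {b // ¬ I b i} × Fin ((n / q - k) / 2) → Fin n := fun z =>
    vtx (n / q - 1 - i - z.2) z.1 (hx z.2).2
  have hab : ∀ z, M i (a z) (b z) := by
    intro z
    refine ⟨?_, ?_, ?_⟩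
    · simp only [a, b, hblob]
    · simp only [a, hblob]; exact z.1.2
    · simp only [a, b, hidx]
      have := z.2.2
      have := i.2
      omega
  have key := card_le_numEdgeComponents (c.labelGraph i) a b ?_ ?_ ?_ ?_
  · rw [Fintype.card_prod, Fintype.card_fin] at key
    refine le_trans (Nat.mul_le_mul_right _ ?_) key
    simpa using hd i
  · intro z
    refine (hadj i _ _).2 ⟨fun h => ?_, (hcol _ _ _ rfl).2 i (hab z)⟩
    have h1 : (z.2 : ℕ) = n / q - 1 - i - z.2 := by
      simpa only [a, b, hidx] using congrArg (fun v : Fin n => (v : ℕ) / q) h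
    have := z.2.2
    have := i.2
    omega
  · intro z v hv
    have h1 := hM _ v (hab z).2.1 hv
    have h2 := hab z
    exact hvert _ _ (h1.1.symm.trans h2.1) (by have := h1.2.2; have := h2.2.2; omega)
  · intro z v hv
    have h2 := hab z
    have h1 := hM _ v (h2.1 ▸ h2.2.1) hv
    exact hvert _ _ (h1.1.symm.trans h2.1.symm) (by have := h1.2.2; have := h2.2.2; omega)
  · intro z w h
    have hb' : (z.1 : Fin q) = w.1 := by
      rcases h with h | h <;>
      · have := congrArg blob h
        simp only [a, b, hblob] at this
        exact this.symm
    have hi' : (z.2 : ℕ) = w.2 := by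
      rcases h with h | h
      · simpa only [a, hidx] using (congrArg (fun v : Fin n => (v : ℕ) / q) h).symm
      · have : (w.2 : ℕ) = n / q - 1 - i - z.2 := by
          simpa only [a, b, hidx] using congrArg (fun v : Fin n => (v : ℕ) / q) h
        have := z.2.2
        have := w.2.2
        have := i.2
        omega
    exact Prod.ext (Subtype.ext hb') (Fin.ext hi')

/-! ### Projective planes and the triangle -/

section Planes

open scoped LinearAlgebra.Projectivization

theorem exists_incidence_of_field (K : Type) [Field K] [Finite K] :
    ∃ I : Fin (Nat.card K ^ 2 + Nat.card K + 1) → Fin (Nat.card K ^ 2 + Nat.card K + 1) → Prop,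
      (∀ a b, ∃ l, I a l ∧ I b l) ∧ ∀ l, Nat.card {a // I a l} = Nat.card K + 1 := by
  classical
  let P := ℙ K (Fin 3 → K)
  have : Fintype P := Fintype.ofFinite _
  have hcard : Nat.card P = Nat.card K ^ 2 + Nat.card K + 1 := by
    rw [Projectivization.card_of_finrank K (Fin 3 → K) (n := 3) (by simp)]
    simp [Finset.sum_range_succ]
    ring
  have hord : Configuration.ProjectivePlane.order P P = Nat.card K := by
    have h := Configuration.ProjectivePlane.card_points P P
    rw [← Nat.card_eq_fintype_card, hcard] at h
    nlinarith [h]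
  let e : P ≃ Fin (Nat.card K ^ 2 + Nat.card K + 1) := Finite.equivFinOfCardEq hcard
  refine ⟨fun a l => e.symm a ∈ e.symm l, fun a b => ?_, fun l => ?_⟩
  · by_cases hab : e.symm a = e.symm b
    · have : 0 < Configuration.lineCount P (e.symm a) := by
        rw [Configuration.ProjectivePlane.lineCount_eq]
        omega
      obtain ⟨l, hl⟩ := (Nat.card_pos_iff.1 this).1
      exact ⟨e l, by simpa using hl, by simpa [← hab] using hl⟩
    · obtain ⟨h1, h2⟩ := Configuration.HasLines.mkLine_ax (L := P) hab
      exact ⟨e (Configuration.HasLines.mkLine hab), by simpa using h1, by simpa using h2⟩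
  · have h := Configuration.ProjectivePlane.pointCount_eq P (e.symm l)
    rw [hord] at h
    exact (Nat.card_congr (e.symm.subtypeEquiv fun _ => Iff.rfl)).trans h

theorem exists_incidence {p : ℕ} (hp : IsPrimePowerOrOne p) :
    ∃ I : Fin (p ^ 2 + p + 1) → Fin (p ^ 2 + p + 1) → Prop,
      (∀ a b, ∃ l, I a l ∧ I b l) ∧ ∀ l, Nat.card {a // I a l} = p + 1 := by
  obtain ⟨r, e, hr, rfl⟩ := hp
  rcases eq_or_ne e 0 with rfl | he
  -- For `p = 1` the triangle, each side labelled by the opposite vertex, replaces the plane.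
  · refine ⟨fun a l => a ≠ l, ?_, ?_⟩
    · rw [pow_zero]
      decide
    · intro l
      rw [Nat.card_eq_fintype_card, Fintype.card_subtype_compl, Fintype.card_fin,
        Fintype.card_unique]
      simp
  · have : Fact r.Prime := ⟨hr⟩
    have h := exists_incidence_of_field (GaloisField r e)
    rwa [GaloisField.card r e he] at h

end Planes

theorem le_fComplete {p k : ℕ} (hp : IsPrimePowerOrOne p) (hk : p ^ 2 + p + 1 ≤ k) (n : ℕ) :
    p ^ 2 * ((n / (p ^ 2 + p + 1) - k) / 2) ≤ fComplete n k := by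
  obtain ⟨I, hI, hcard⟩ := exists_incidence hp
  refine le_fComplete_of_incidence n (Nat.succ_pos _)
    (fun b i => ∃ h : (i : ℕ) < p ^ 2 + p + 1, I b ⟨i, h⟩) (fun a b => ?_) (fun i => ?_)
  · obtain ⟨l, hl⟩ := hI a b
    exact ⟨Fin.castLE hk l, ⟨l.2, hl.1⟩, ⟨l.2, hl.2⟩⟩
  · classical
    by_cases hi : (i : ℕ) < p ^ 2 + p + 1
    · have h := hcard ⟨i, hi⟩
      simp only [hi, exists_true_left]
      rw [Nat.card_eq_fintype_card] at h ⊢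
      rw [Fintype.card_subtype_compl, Fintype.card_fin, h]
      omega
    -- A surplus colour is incident with no blob, so it is a matching in all of them.
    · simp [hi]
      omega

/-! ### Asymptotic form -/

theorem exists_upper_error {k : ℕ} (hk : 2 ≤ k) :
    ∃ ε : ℕ → ℝ, Tendsto ε atTop (𝓝 0) ∧ ∀ n : ℕ,
      (fComplete n k : ℝ) ≤
        (n : ℝ) * (1 / 2 - 1 / (2 * Real.sqrt (k : ℝ))) * (1 + ε n) := by
  have hk0 : (0 : ℝ) < k := by positivity
  have hs : 1 < Real.sqrt k := by
    rw [Real.lt_sqrt (by norm_num)]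
    norm_cast
  have hA : 0 < 1 / 2 - 1 / (2 * Real.sqrt (k : ℝ)) := by
    rw [sub_pos]
    exact one_div_lt_one_div_of_lt (by norm_num) (by linarith)
  set A := 1 / 2 - 1 / (2 * Real.sqrt (k : ℝ)) with hAdef
  -- The counting inequality solved for `f / n`. For small `n` the radicand is negative, its root is
  -- `0`, and the bound reads `f ≤ n / 2`.
  let g : ℕ → ℝ := fun n => 1 / 2 - Real.sqrt ((1 - (1 + 3 * k) / n) / k) / 2
  have hg : Tendsto g atTop (𝓝 A) := by
    have h1 : Tendsto (fun n : ℕ => (1 + 3 * k : ℝ) / n) atTop (𝓝 0) :=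
      tendsto_const_div_atTop_nhds_zero_nat _
    have h2 := ((((h1.const_sub 1).div_const (k : ℝ)).sqrt).div_const 2).const_sub (1 / 2)
    have : 1 / 2 - Real.sqrt ((1 - 0) / k) / 2 = A := by
      rw [hAdef, sub_zero, Real.sqrt_div zero_le_one, Real.sqrt_one]
      field_simp
    rwa [this] at h2
  refine ⟨fun n => g n / A - 1, ?_, fun n => ?_⟩
  · simpa [hA.ne'] using (hg.div_const A).sub_const 1
  · have hrw : (n : ℝ) * A * (1 + (g n / A - 1)) = n * g n := by
      field_simp
      ring
    rw [hrw]
    obtain ⟨h1, h2⟩ := fComplete_upper n k (by omega)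
    rcases Nat.eq_zero_or_pos n with rfl | hn
    · have : fComplete 0 k = 0 := by omega
      simp [this]
    have hn0 : (0 : ℝ) < n := by exact_mod_cast hn
    have h1' : (2 : ℝ) * fComplete n k ≤ n := by exact_mod_cast h1
    have h2' : (n : ℝ) * (n - 1) ≤ k * ((n - 2 * fComplete n k) ^ 2 + 3 * n) := by
      have := (Nat.cast_le (α := ℝ)).2 h2
      push_cast [Nat.cast_sub h1, Nat.cast_sub hn] at this
      exact this
    have h3 : Real.sqrt ((1 - (1 + 3 * k) / n) / k) ≤ (n - 2 * fComplete n k) / n := by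
      refine Real.sqrt_le_iff.2 ⟨by apply div_nonneg <;> linarith, ?_⟩
      rw [div_le_iff₀ hk0, div_pow, div_mul_eq_mul_div, le_div_iff₀ (by positivity)]
      have : (1 - (1 + 3 * (k : ℝ)) / n) * n ^ 2 = n * (n - 1) - 3 * k * n := by
        field_simp
        ring
      rw [this]
      linarith
    rw [le_div_iff₀ hn0] at h3
    simp only [g]
    linarith

theorem exists_lower_error {p k : ℕ} (hp : IsPrimePowerOrOne p) (hk : p ^ 2 + p + 1 ≤ k) :
    ∃ δ : ℕ → ℝ, Tendsto δ atTop (𝓝 0) ∧ ∀ n : ℕ,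
      (n : ℝ) * (1 / 2 - ((p : ℝ) + 1) / (2 * ((p : ℝ) ^ 2 + (p : ℝ) + 1))) * (1 + δ n) ≤
        (fComplete n k : ℝ) := by
  set q : ℝ := (p : ℝ) ^ 2 + p + 1 with hq
  have hq0 : 0 < q := by positivity
  -- The loss `k + 2` per blob is `k` from the shifts by colour plus one for each rounded division.
  refine ⟨fun n => -(q * (k + 2)) / n, tendsto_const_div_atTop_nhds_zero_nat _, fun n => ?_⟩
  rcases Nat.eq_zero_or_pos n with rfl | hn
  · simp
  have hn0 : (0 : ℝ) < n := by exact_mod_cast hn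
  have hrw : (n : ℝ) * (1 / 2 - ((p : ℝ) + 1) / (2 * q)) * (1 + -(q * (k + 2)) / n) =
      p ^ 2 * ((n / q - k - 2) / 2) := by
    have : (p : ℝ) ^ 2 = q - (p + 1) := by rw [hq]; ring
    rw [this]
    field_simp
    ring
  rw [hrw]
  have h := (Nat.cast_le (α := ℝ)).2 (le_fComplete hp hk n)
  refine le_trans ?_ h
  push_cast
  refine mul_le_mul_of_nonneg_left ?_ (by positivity)
  have h1 : (n : ℝ) / q < (n / (p ^ 2 + p + 1) : ℕ) + 1 := by
    rw [div_lt_iff₀ hq0, hq]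
    have := Nat.lt_mul_div_succ n (Nat.succ_pos (p ^ 2 + p))
    rw [mul_comm]
    exact_mod_cast this
  have h2 : n / (p ^ 2 + p + 1) ≤ 2 * ((n / (p ^ 2 + p + 1) - k) / 2) + 1 + k := by omega
  have h2' := (Nat.cast_le (α := ℝ)).2 h2
  push_cast at h1 h2' ⊢
  linarith

theorem mainTheorem4 (k p : ℕ) (hk : 3 ≤ k)
    (hp : IsGreatest {q : ℕ | IsPrimePowerOrOne q ∧ q ^ 2 + q + 1 ≤ k} p) :
    (∃ ε : ℕ → ℝ, Tendsto ε atTop (𝓝 0) ∧ ∀ n : ℕ,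
      (fComplete n k : ℝ) ≤
        (n : ℝ) * (1 / 2 - 1 / (2 * Real.sqrt (k : ℝ))) * (1 + ε n)) ∧
    (∃ δ : ℕ → ℝ, Tendsto δ atTop (𝓝 0) ∧ ∀ n : ℕ,
      (n : ℝ) * (1 / 2 - ((p : ℝ) + 1) / (2 * ((p : ℝ) ^ 2 + (p : ℝ) + 1))) * (1 + δ n) ≤
        (fComplete n k : ℝ)) := 
  ⟨exists_upper_error (by omega), exists_lower_error hp.1.1 hp.1.2⟩
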